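/- **Hub model with a null component.** Let $0\le n_L\le n$ and $T$ be integers. The nodes are $1,\dots,n$, and the nodes $1,\dots,n_L$ are the leaders. The parameters are a probability vector $\rho=(\rho_0,\dots,\rho_{n_L})$ and a matrix $A=(A_{ij})_{0\le i\le n_L,\,1\le j\le n}$ with entries in $[0,1]$ and $A_{ii}=1$ for $1\le i\le n_L$ (row $0$ is the null component). One observes $T$ independent groups $G^{(t)}\in\{0,1\}^n$: a latent label $z_*^{(t)}\in\{0,\dots,n_L\}$ is drawn with $\mathbb P(z_*^{(t)}=i)=\rho_i$ and, given $z_*^{(t)}=i$, the coordinates of $G^{(t)}$ are independent with $\mathbb P(G^{(t)}_j=1\mid z_*^{(t)}=i)=A_{ij}$. For a label assignment $z\in\{0,\dots,n_L\}^T$ let $$L_G(A'\mid z)=\sum_{t=1}^T\sum_{j=1}^n\Big[G_j^{(t)}\log A'_{z^{(t)}j}+(1-G_j^{(t)})\log(1-A'_{z^{(t)}j})\Big],\qquad L_G(z)=\max_{A'}L_G(A'\mid z)$$ (with $\log 0=-\infty$, $0\log 0=0$), where $A'$ ranges over all matrices with entries in $[0,1]$ and $A'_{ii}=1$ for $1\le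 i\le n_L$; let $\hat z$ be any maximizer of $L_G(z)$ over $z$, and $T_e=\#\{t: z_*^{(t)}\ne\hat z^{(t)}\}$. Consider a sequence of such models, in which $n_L,n,T,\rho,A$ and the numbers $d,v>0$ below may vary along the sequence. Assume throughout that (i) for each $i=1,\dots,n_L$ there is a set $V_i\subset\{1,\dots,n\}$ with $|V_i|\ge vn/n_L$ and $A_{ij}-A_{i'j}\ge d$ for all $j\in V_i$ and all $i'\in\{0,\dots,n_L\}$, $i'\ne i$. **Theorem 9.** Suppose also that there are positive constants $c_{\min},c_{\max},c_0$ such that $c_{\min}/n_L\le\rho_i\le c_{\max}/n_L$ for $i=0,\dots,n_L$, and (ii) $A_{ii'}\le c_0/n_L$ for $i=0,\dots,n_L$, $i'=1,\dots,n_L$, $i\ne i'$. If $n_L\to\infty$, $n\to\infty$, $T\to\infty$ and $$\frac{n_L^2\log n_L}{T}=o(1),\qquad \frac{n_L^5\log T}{d^2vT}=o(1),\qquad \frac{n_L^8\log n_L}{d^4v^2n}=o(1),$$ then $T_e/T=o_p(1)$, i.e. $\mathbb P(T_e/T\ge\varepsilon)\to0$ for every $\varepsilon>0$. **Theorem 9′.**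 Suppose instead that $n_L$ is fixed and that there are constants $c_{\min}>0$ and $b<1$ such that $\rho_i\ge c_{\min}$ for $i=0,\dots,n_L$, and (ii′) $A_{ii'}\le b$ for $i=0,\dots,n_L$, $i'=1,\dots,n_L$, $i\ne i'$. If $n\to\infty$, $T\to\infty$, $(\log T)/(d^2vT)=o(1)$ and $d^4v^2n\to\infty$, then $T_e/T=o_p(1)$. -/

import Mathlib

open MeasureTheory Filter Topology
open scoped ENNReal

noncomputable section

namespace HubNull

/-- The admissible connection matrices with rows `0, ..., nL` and columns indexed by the `n` nodes.
Row `0` is the null component (`A 0 j = π_j`), row `i.succ` belongs to leader `i`; the leaders are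
the first `nL` nodes, leader `i` being the node `Fin.castLE hn i`.  Entries lie in `[0, 1]`, and a
leader belongs to every group of which it is the hub. -/
structure IsConnMatrix {nL n : ℕ} (hn : nL ≤ n) (A : Fin (nL + 1) → Fin n → ℝ) : Prop where
  nonneg : ∀ i j, 0 ≤ A i j
  le_one : ∀ i j, A i j ≤ 1
  diag : ∀ i : Fin nL, A i.succ (Fin.castLE hn i) = 1

/-- Parameters `(ρ, A)` of the hub model with a null component. -/
structure Params {nL n : ℕ} (hn : nL ≤ n) where
  /-- hub probabilities `ρ_0, ..., ρ_{nL}` -/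
  ρ : Fin (nL + 1) → ℝ
  /-- connection matrix, with row `0` equal to `π` -/
  A : Fin (nL + 1) → Fin n → ℝ
  ρ_nonneg : ∀ i, 0 ≤ ρ i
  ρ_sum : ∑ i, ρ i = 1
  conn : IsConnMatrix hn A

/-- The Bernoulli law on `Bool` with success probability `p`. -/
def bern (p : ℝ) : Measure Bool :=
  ENNReal.ofReal p • Measure.dirac true + ENNReal.ofReal (1 - p) • Measure.dirac false

/-- The joint law of the hub label and the group for a single observation: the label `i` has
probability `ρ i`, and given `i` the nodes appear independently, node `j` with probability
`A i j`. -/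
def groupLaw {nL n : ℕ} {hn : nL ≤ n} (θ : Params hn) :
    Measure (Fin (nL + 1) × (Fin n → Bool)) :=
  ∑ i, ENNReal.ofReal (θ.ρ i) •
    (Measure.dirac i).prod (Measure.pi fun j => bern (θ.A i j))

/-- Outcomes of `T` observations: true hub labels together with the groups. -/
abbrev Sample (nL n T : ℕ) := Fin T → Fin (nL + 1) × (Fin n → Bool)

/-- The law of `T` independent observations. -/
def sampleLaw {nL n : ℕ} {hn : nL ≤ n} (θ : Params hn) (T : ℕ) : Measure (Sample nL n T) :=
  Measure.pi fun _ => groupLaw θ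

/-- The true labels `z_*`. -/
def trueLabels {nL n T : ℕ} (ω : Sample nL n T) : Fin T → Fin (nL + 1) := fun t => (ω t).1

/-- The observed groups `G`. -/
def groups {nL n T : ℕ} (ω : Sample nL n T) : Fin T → Fin n → Bool := fun t => (ω t).2

/-- The logarithm of a nonnegative real number, with `log 0 = -∞`. -/
def elog (x : ℝ) : EReal := ENNReal.log (ENNReal.ofReal x)

/-- The log-likelihood `L_G(A | z)`, where `0 * log 0 = 0` and `log 0 = -∞`. -/
def logLik {nL n T : ℕ} (G : Fin T → Fin n → Bool) (z : Fin T → Fin (nL + 1))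
    (A : Fin (nL + 1) → Fin n → ℝ) : EReal :=
  ∑ t, ∑ j, if G t j then elog (A (z t) j) else elog (1 - A (z t) j)

/-- The profile log-likelihood `L_G(z)`: the maximum of `L_G(A | z)` over all admissible connection
matrices.  It is `-∞` when some group is assigned a leader that does not appear in it. -/
def profileLogLik {nL n T : ℕ} (hn : nL ≤ n) (G : Fin T → Fin n → Bool)
    (z : Fin T → Fin (nL + 1)) : EReal :=
  ⨆ (A : Fin (nL + 1) → Fin n → ℝ) (_ : IsConnMatrix hn A), logLik G z A

/-- `z` maximizes the profile log-likelihood over all label assignments. -/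
def IsMaxProfile {nL n T : ℕ} (hn : nL ≤ n) (G : Fin T → Fin n → Bool)
    (z : Fin T → Fin (nL + 1)) : Prop :=
  ∀ z' : Fin T → Fin (nL + 1), profileLogLik hn G z' ≤ profileLogLik hn G z

/-- `T_e / T`, the fraction of groups whose label is wrong. -/
def errorRate {nL T : ℕ} (zs z : Fin T → Fin (nL + 1)) : ℝ :=
  ((Finset.univ.filter fun t => zs t ≠ z t).card : ℝ) / (T : ℝ)

/-- Separation: for each leader `i` there is a set `V` of at least `v n / nL` nodes that are more
likely, by at least `d`, to join a group of hub `i` than a group with any other label, including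
the null label `0`. -/
def Separated {nL n : ℕ} (A : Fin (nL + 1) → Fin n → ℝ) (d v : ℝ) : Prop :=
  ∀ i : Fin nL, ∃ V : Finset (Fin n), v * (n : ℝ) / (nL : ℝ) ≤ (V.card : ℝ) ∧
    ∀ j ∈ V, ∀ k : Fin (nL + 1), k ≠ i.succ → d ≤ A i.succ j - A k j

/-- Every leader joins groups with another label (or with the null label) with probability at
most `b`. -/
def LeaderBound {nL n : ℕ} (hn : nL ≤ n) (A : Fin (nL + 1) → Fin n → ℝ) (b : ℝ) : Prop :=
  ∀ (k : Fin (nL + 1)) (i : Fin nL), k ≠ i.succ → A k (Fin.castLE hn i) ≤ b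

end HubNull

end

/-! A fixed labelling `z` with a fixed matrix `Q` has likelihood at least that of the truth, at
squared distance at least `s` from it, with probability at most `exp (-s/8)`: this is a Chernoff
bound with exponent 1/2, through the Hellinger affinity of Bernoulli laws (`sampleLaw_lik_le`).
Given `z`, the likelihood is maximal at empirical frequencies, so only finitely many matrices
compete, and a union bound over labellings and frequency matrices costs `T log (nL+1) + (nL+1) n log
(T+1)` in the exponent. The growth conditions make this negligible against `d² v n T / nL`, so the
estimate is close to the truth in squared distance.

Distinct rows of `A` are at squared distance at least `d² v n / nL`. Hence, when each estimated
class `k` is attributed to the row `σ k` of `A` nearest to its fitted row, all but `η T`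
observations have true label `σ` of their estimated label (`IsPure`).

It remains to control classes with `σ k ≠ k`. Finite likelihood forces every group placed in a
leader's class to contain that leader. If leaders rarely join foreign groups, Chebyshev bounds make
all the misattributed classes small together, and class `0`, which has no hub, is no larger than one
rare label (`IsPure.errorRate_le_of_rare`). With finitely many frequent labels, `σ` must be
surjective, hence bijective; a class attributed to the wrong label would then hold nearly all groups
of that label, all containing a leader that joins at most a fraction `b` of them up to sampling
error. So `σ` is the identity (`IsPure.errorRate_le_of_frequent`). -/

noncomputable section

namespace HubNull

/-! ### The laws as finite weighted sums -/

/-- The mass that the Bernoulli law with parameter `p` gives to `b`. -/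
def bernWeight (p : ℝ) (b : Bool) : ℝ := if b then p else 1 - p

lemma bernWeight_nonneg {p : ℝ} (h0 : 0 ≤ p) (h1 : p ≤ 1) (b : Bool) : 0 ≤ bernWeight p b := by
  unfold bernWeight; split_ifs <;> linarith

lemma bern_singleton {p : ℝ} (b : Bool) : bern p {b} = ENNReal.ofReal (bernWeight p b) := by
  cases b <;> simp [bern, bernWeight]

lemma isProbabilityMeasure_bern {p : ℝ} (h0 : 0 ≤ p) (h1 : p ≤ 1) :
    IsProbabilityMeasure (bern p) := by
  constructor
  simp only [bern, Measure.coe_add, Measure.coe_smul, Pi.add_apply, Pi.smul_apply, measure_univ,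
    smul_eq_mul, mul_one]
  rw [← ENNReal.ofReal_add h0 (by linarith)]
  simp

section Model

variable {nL n T : ℕ} {hn : nL ≤ n} (θ : Params hn)

instance isProbabilityMeasure_bern_entry (i : Fin (nL + 1)) (j : Fin n) :
    IsProbabilityMeasure (bern (θ.A i j)) :=
  isProbabilityMeasure_bern (θ.conn.nonneg i j) (θ.conn.le_one i j)

instance isProbabilityMeasure_groupLaw : IsProbabilityMeasure (groupLaw θ) := by
  constructor
  simp only [groupLaw, Measure.coe_finsetSum, Finset.sum_apply, Measure.coe_smul, Pi.smul_apply,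
    measure_univ, smul_eq_mul, mul_one]
  rw [← ENNReal.ofReal_sum_of_nonneg (fun i _ => θ.ρ_nonneg i), θ.ρ_sum, ENNReal.ofReal_one]

instance isProbabilityMeasure_sampleLaw : IsProbabilityMeasure (sampleLaw θ T) := by
  unfold sampleLaw; infer_instance

/-- The mass of a single observation. -/
def groupWeight (x : Fin (nL + 1) × (Fin n → Bool)) : ℝ :=
  θ.ρ x.1 * ∏ j, bernWeight (θ.A x.1 j) (x.2 j)

lemma groupLaw_prod (i : Fin (nL + 1)) (B : Set (Fin n → Bool)) :
    groupLaw θ ({i} ×ˢ B) =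
      ENNReal.ofReal (θ.ρ i) * Measure.pi (fun j => bern (θ.A i j)) B := by
  simp only [groupLaw, Measure.coe_finsetSum, Finset.sum_apply, Measure.coe_smul, Pi.smul_apply,
    smul_eq_mul, Measure.prod_prod]
  rw [Finset.sum_eq_single i]
  · simp
  · intro k _ hk
    simp [hk]
  · simp

lemma groupLaw_singleton (x : Fin (nL + 1) × (Fin n → Bool)) :
    groupLaw θ {x} = ENNReal.ofReal (groupWeight θ x) := by
  obtain ⟨i, g⟩ := x
  rw [← Set.singleton_prod_singleton, groupLaw_prod, Measure.pi_singleton, groupWeight,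
    ENNReal.ofReal_mul (θ.ρ_nonneg i), ENNReal.ofReal_prod_of_nonneg]
  · simp [bern_singleton]
  · exact fun j _ => bernWeight_nonneg (θ.conn.nonneg i j) (θ.conn.le_one i j) _

lemma groupWeight_nonneg (x : Fin (nL + 1) × (Fin n → Bool)) : 0 ≤ groupWeight θ x :=
  mul_nonneg (θ.ρ_nonneg _) (Finset.prod_nonneg fun j _ =>
    bernWeight_nonneg (θ.conn.nonneg _ j) (θ.conn.le_one _ j) _)

lemma groupLaw_label (i : Fin (nL + 1)) :
    (groupLaw θ).real {x | x.1 = i} = θ.ρ i := by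
  have h : {x : Fin (nL + 1) × (Fin n → Bool) | x.1 = i} = {i} ×ˢ Set.univ := by ext; simp
  rw [h, measureReal_def, groupLaw_prod, measure_univ, mul_one,
    ENNReal.toReal_ofReal (θ.ρ_nonneg i)]

lemma groupLaw_label_mem (i : Fin (nL + 1)) (j : Fin n) :
    (groupLaw θ).real {x | x.1 = i ∧ x.2 j = true} = θ.ρ i * θ.A i j := by
  have h : {x : Fin (nL + 1) × (Fin n → Bool) | x.1 = i ∧ x.2 j = true} =
      {i} ×ˢ (Function.eval (β := fun _ : Fin n => Bool) j ⁻¹' ({true} : Set Bool)) := by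
    ext; simp
  rw [h, measureReal_def, groupLaw_prod,
    (measurePreserving_eval (fun j => bern (θ.A i j)) j).measure_preimage
      (MeasurableSet.of_discrete.nullMeasurableSet), bern_singleton, ENNReal.toReal_mul,
    ENNReal.toReal_ofReal (θ.ρ_nonneg i),
    ENNReal.toReal_ofReal (bernWeight_nonneg (θ.conn.nonneg i j) (θ.conn.le_one i j) _)]
  simp [bernWeight]

/-- The mass of a sample. -/
def sampleWeight (ω : Sample nL n T) : ℝ := ∏ t, groupWeight θ (ω t)

lemma sampleWeight_nonneg (ω : Sample nL n T) : 0 ≤ sampleWeight θ ω :=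
  Finset.prod_nonneg fun _ _ => groupWeight_nonneg θ _

lemma sampleLaw_singleton (ω : Sample nL n T) :
    sampleLaw θ T {ω} = ENNReal.ofReal (sampleWeight θ ω) := by
  rw [sampleLaw, Measure.pi_singleton, sampleWeight,
    ENNReal.ofReal_prod_of_nonneg fun _ _ => groupWeight_nonneg θ _]
  simp [groupLaw_singleton]

open Classical in
lemma sampleLaw_eq_sum (S : Set (Sample nL n T)) :
    sampleLaw θ T S = ENNReal.ofReal (∑ ω with ω ∈ S, sampleWeight θ ω) := by
  rw [ENNReal.ofReal_sum_of_nonneg fun _ _ => sampleWeight_nonneg θ _]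
  simp_rw [← sampleLaw_singleton]
  rw [sum_measure_singleton]
  simp

/-! ### Concentration of counts -/

/-- Chebyshev's inequality for the number of observations with a given property. -/
lemma sampleLaw_count_deviation (E : Fin (nL + 1) × (Fin n → Bool) → Prop) [DecidablePred E]
    {q s : ℝ} (hq : (groupLaw θ).real {x | E x} ≤ q) (hs : 0 < s) :
    sampleLaw θ T {ω | s ≤ |((Finset.univ.filter fun t => E (ω t)).card : ℝ) -
      T * (groupLaw θ).real {x | E x}|} ≤ ENNReal.ofReal (T * q / s ^ 2) := by
  set X : Fin (nL + 1) × (Fin n → Bool) → ℝ := Set.indicator {x | E x} 1 with hX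
  have hint : ∫ x, X x ∂(groupLaw θ) = (groupLaw θ).real {x | E x} :=
    integral_indicator_one MeasurableSet.of_discrete
  have hL : MemLp X 2 (groupLaw θ) := MemLp.of_discrete
  have hcount : ∀ ω : Sample nL n T, ((Finset.univ.filter fun t => E (ω t)).card : ℝ) =
      (∑ t, fun ω : Sample nL n T => X (ω t)) ω := by
    intro ω
    rw [Finset.sum_apply, Finset.card_filter]
    push_cast
    exact Finset.sum_congr rfl fun t _ => by simp [hX, Set.indicator_apply]
  have hmean : ∫ ω, (∑ t, fun ω : Sample nL n T => X (ω t)) ω ∂(sampleLaw θ T) =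
      T * (groupLaw θ).real {x | E x} := by
    simp_rw [Finset.sum_apply]
    rw [integral_finsetSum _ fun _ _ => Integrable.of_finite]
    have : ∀ t : Fin T, ∫ ω, X (ω t) ∂(sampleLaw θ T) = (groupLaw θ).real {x | E x} := by
      intro t
      rw [← hint, sampleLaw]
      exact integral_comp_eval (μ := fun _ : Fin T => groupLaw θ)
        hL.aestronglyMeasurable
    simp [this]
  have hvar : ProbabilityTheory.variance (∑ t, fun ω : Sample nL n T => X (ω t)) (sampleLaw θ T)
      ≤ T * q := by
    rw [sampleLaw, ProbabilityTheory.variance_sum_pi (μ := fun _ : Fin T => groupLaw θ)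
      (X := fun _ => X) fun _ => hL]
    -- An indicator is its own square, so its variance is at most its mean. Keeping `q` rather than
    -- 1 is what makes rare events cheap.
    have h1 : ProbabilityTheory.variance X (groupLaw θ) ≤ q := by
      refine (ProbabilityTheory.variance_le_expectation_sq hL.aestronglyMeasurable).trans ?_
      refine le_trans (le_of_eq ?_) hq
      rw [← hint]
      refine integral_congr_ae (ae_of_all _ fun x => ?_)
      by_cases hx : E x <;> simp [hX, hx]
    calc _ ≤ ∑ _t : Fin T, q := Finset.sum_le_sum fun _ _ => h1
      _ = T * q := by simp
  have hcheb := ProbabilityTheory.meas_ge_le_variance_div_sq (μ := sampleLaw θ T)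
    (X := ∑ t, fun ω : Sample nL n T => X (ω t)) MemLp.of_discrete hs
  rw [hmean] at hcheb
  simp_rw [hcount]
  refine hcheb.trans (ENNReal.ofReal_le_ofReal ?_)
  gcongr

end Model

/-! ### The likelihood and its maximum over connection matrices -/

section Likelihood

variable {nL n T : ℕ}

/-- The likelihood of the groups `G` given the labels `z`. -/
def lik (G : Fin T → Fin n → Bool) (z : Fin T → Fin (nL + 1))
    (A : Fin (nL + 1) → Fin n → ℝ) : ℝ :=
  ∏ t, ∏ j, bernWeight (A (z t) j) (G t j)

lemma lik_nonneg (G : Fin T → Fin n → Bool) (z : Fin T → Fin (nL + 1))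
    {A : Fin (nL + 1) → Fin n → ℝ} (h0 : ∀ i j, 0 ≤ A i j) (h1 : ∀ i j, A i j ≤ 1) :
    0 ≤ lik G z A :=
  Finset.prod_nonneg fun _ _ => Finset.prod_nonneg fun _ _ => bernWeight_nonneg (h0 _ _) (h1 _ _) _

lemma ennreal_log_prod {ι : Type*} (s : Finset ι) (f : ι → ℝ≥0∞) :
    ENNReal.log (∏ i ∈ s, f i) = ∑ i ∈ s, ENNReal.log (f i) := by
  classical
  induction s using Finset.induction_on with
  | empty => simp
  | insert a s ha ih => rw [Finset.prod_insert ha, Finset.sum_insert ha, ENNReal.log_mul_add, ih]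

/-- Passing to products avoids sums of infinite logarithms: likelihood `0` corresponds to `⊥`. -/
lemma logLik_eq (G : Fin T → Fin n → Bool) (z : Fin T → Fin (nL + 1))
    {A : Fin (nL + 1) → Fin n → ℝ} (h0 : ∀ i j, 0 ≤ A i j) (h1 : ∀ i j, A i j ≤ 1) :
    logLik G z A = ENNReal.log (ENNReal.ofReal (lik G z A)) := by
  have hb : ∀ t j, 0 ≤ bernWeight (A (z t) j) (G t j) := fun t j =>
    bernWeight_nonneg (h0 _ _) (h1 _ _) _
  rw [lik, ENNReal.ofReal_prod_of_nonneg fun t _ => Finset.prod_nonneg fun j _ => hb t j,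
    ennreal_log_prod, logLik]
  refine Finset.sum_congr rfl fun t _ => ?_
  rw [ENNReal.ofReal_prod_of_nonneg fun j _ => hb t j, ennreal_log_prod]
  refine Finset.sum_congr rfl fun j _ => ?_
  unfold bernWeight elog
  split_ifs <;> rfl

/-- The binomial likelihood is maximal at the empirical frequency. -/
lemma pow_mul_one_sub_pow_le {a : ℝ} (h0 : 0 ≤ a) (h1 : a ≤ 1) (m l : ℕ) :
    a ^ m * (1 - a) ^ l ≤ ((m : ℝ) / (m + l : ℕ)) ^ m * (1 - (m : ℝ) / (m + l : ℕ)) ^ l := by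
  rcases Nat.eq_zero_or_pos m with rfl | hm
  · simpa using pow_le_one₀ (by linarith) (by linarith)
  rcases Nat.eq_zero_or_pos l with rfl | hl
  · have : (m : ℝ) ≠ 0 := by positivity
    simpa [this] using pow_le_one₀ h0 h1
  have hm' : (0 : ℝ) < m := by exact_mod_cast hm
  have hl' : (0 : ℝ) < l := by exact_mod_cast hl
  push_cast
  set N : ℝ := m + l with hN
  have hNpos : 0 < N := by positivity
  have e1 : 1 - (m : ℝ) / N = l / N := by field_simp; linarith
  rw [e1]
  -- Weighted AM-GM for the ratios of `a` and `1 - a` to the empirical frequencies; their weighted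
  -- mean is 1.
  have key := Real.geom_mean_le_arith_mean2_weighted (w₁ := m / N) (w₂ := l / N)
    (p₁ := a * N / m) (p₂ := (1 - a) * N / l) (by positivity) (by positivity) (by positivity)
    (div_nonneg (mul_nonneg (by linarith) hNpos.le) hl'.le) (by rw [← e1]; ring)
  have hp2 : 0 ≤ (1 - a) * N / l := div_nonneg (mul_nonneg (by linarith) hNpos.le) hl'.le
  have e2 : m / N * (a * N / m) + l / N * ((1 - a) * N / l) = 1 := by field_simp; ring
  rw [e2] at key
  have key2 := Real.rpow_le_rpow (by positivity) key hNpos.le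
  rw [Real.one_rpow, Real.mul_rpow (by positivity) (by positivity), ← Real.rpow_mul (by positivity),
    ← Real.rpow_mul hp2, div_mul_cancel₀ _ hNpos.ne', div_mul_cancel₀ _ hNpos.ne',
    Real.rpow_natCast, Real.rpow_natCast] at key2
  have e3 : a ^ m * (1 - a) ^ l =
      ((m / N) ^ m * (l / N) ^ l) * ((a * N / m) ^ m * ((1 - a) * N / l) ^ l) := by
    rw [mul_mul_mul_comm, ← mul_pow, ← mul_pow]
    congr 2 <;> field_simp
  rw [e3]
  exact mul_le_of_le_one_right (by positivity) key2

/-- Matrices whose entries in row `k` are multiples of `1 / #{t | z t = k}`, indexed by their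
numerators. -/
def freqMatrix (z : Fin T → Fin (nL + 1)) (m : Fin (nL + 1) → Fin n → Fin (T + 1)) :
    Fin (nL + 1) → Fin n → ℝ :=
  fun k j => min 1 ((m k j : ℝ) / ((Finset.univ.filter fun t => z t = k).card : ℝ))

lemma freqMatrix_nonneg (z : Fin T → Fin (nL + 1)) (m : Fin (nL + 1) → Fin n → Fin (T + 1))
    (k : Fin (nL + 1)) (j : Fin n) : 0 ≤ freqMatrix z m k j :=
  le_min zero_le_one (by positivity)

/-- The cap at 1 is there because numerators range over all of `Fin (T + 1)`, whatever the class
sizes, so that the index set does not depend on `z`. -/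
lemma freqMatrix_le_one (z : Fin T → Fin (nL + 1)) (m : Fin (nL + 1) → Fin n → Fin (T + 1))
    (k : Fin (nL + 1)) (j : Fin n) : freqMatrix z m k j ≤ 1 := min_le_left _ _

lemma prod_bernWeight_class (s : Finset (Fin T)) (g : Fin T → Bool) (a : ℝ) :
    ∏ t ∈ s, bernWeight a (g t) =
      a ^ (s.filter fun t => g t = true).card * (1 - a) ^ (s.filter fun t => ¬ g t = true).card := by
  unfold bernWeight
  rw [Finset.prod_ite, Finset.prod_const, Finset.prod_const]

lemma lik_eq_prod_class (G : Fin T → Fin n → Bool) (z : Fin T → Fin (nL + 1))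
    (A : Fin (nL + 1) → Fin n → ℝ) :
    lik G z A = ∏ j, ∏ k, ∏ t with z t = k, bernWeight (A k j) (G t j) := by
  rw [lik, Finset.prod_comm]
  refine Finset.prod_congr rfl fun j _ => ?_
  rw [← Finset.prod_fiberwise (s := Finset.univ) (g := z)]
  refine Finset.prod_congr rfl fun k _ => Finset.prod_congr rfl fun t ht => ?_
  rw [(Finset.mem_filter.mp ht).2]

/-- The likelihood splits into one binomial factor per class and node. The constraint on leaders is
dropped, which can only enlarge the maximum. -/
lemma exists_lik_le_freqMatrix (G : Fin T → Fin n → Bool) (z : Fin T → Fin (nL + 1)) :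
    ∃ m : Fin (nL + 1) → Fin n → Fin (T + 1), ∀ A : Fin (nL + 1) → Fin n → ℝ,
      (∀ i j, 0 ≤ A i j) → (∀ i j, A i j ≤ 1) → lik G z A ≤ lik G z (freqMatrix z m) := by
  refine ⟨fun k j => ⟨((Finset.univ.filter fun t => z t = k).filter fun t => G t j = true).card,
    Nat.lt_succ_of_le ((Finset.card_le_univ _).trans (by simp))⟩, fun A h0 h1 => ?_⟩
  rw [lik_eq_prod_class, lik_eq_prod_class]
  have hb : ∀ k j b, 0 ≤ bernWeight (A k j) b := fun k j b => bernWeight_nonneg (h0 k j) (h1 k j) b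
  refine Finset.prod_le_prod (fun j _ => Finset.prod_nonneg fun k _ => Finset.prod_nonneg
    fun t _ => hb _ _ _) fun j _ => Finset.prod_le_prod (fun k _ => Finset.prod_nonneg
    fun t _ => hb _ _ _) fun k _ => ?_
  rw [prod_bernWeight_class, prod_bernWeight_class]
  have hsum := Finset.card_filter_add_card_filter_not (s := Finset.univ.filter fun t => z t = k)
    (fun t => G t j = true)
  set M := ((Finset.univ.filter fun t => z t = k).filter fun t => G t j = true).card
  set L := ((Finset.univ.filter fun t => z t = k).filter fun t => ¬ G t j = true).card
  have hf : min 1 ((M : ℝ) / ((Finset.univ.filter fun t => z t = k).card : ℝ)) =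
      (M : ℝ) / (M + L : ℕ) := by
    -- The cap is inactive for true counts; an empty class gives `0 / 0 = 0`.
    rw [← hsum, min_eq_right]
    apply div_le_one_of_le₀ <;> push_cast <;> [simp; positivity]
  refine (pow_mul_one_sub_pow_le (h0 k j) (h1 k j) M L).trans_eq ?_
  rw [← hf]
  rfl

variable {hn : nL ≤ n} (θ : Params hn)

lemma sampleWeight_eq (ω : Sample nL n T) :
    sampleWeight θ ω = (∏ t, θ.ρ (ω t).1) * lik (groups ω) (trueLabels ω) θ.A := by
  simp [sampleWeight, groupWeight, lik, Finset.prod_mul_distrib, trueLabels, groups]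

/-- At a sample of positive mass, the maximum likelihood labels are feasible, and some matrix of
frequencies explains the groups at least as well as the truth. -/
lemma IsMaxProfile.spec {ω : Sample nL n T} {z : Fin T → Fin (nL + 1)}
    (hz : IsMaxProfile hn (groups ω) z) (hω : sampleWeight θ ω ≠ 0) :
    (∀ (t : Fin T) (k : Fin nL), z t = k.succ → (ω t).2 (Fin.castLE hn k) = true) ∧
    ∃ m, lik (groups ω) (trueLabels ω) θ.A ≤ lik (groups ω) z (freqMatrix z m) := by
  have hpos : 0 < lik (groups ω) (trueLabels ω) θ.A := by
    refine lt_of_le_of_ne (lik_nonneg _ _ θ.conn.nonneg θ.conn.le_one) fun h => hω ?_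
    rw [sampleWeight_eq, ← h, mul_zero]
  have hprof : logLik (groups ω) (trueLabels ω) θ.A ≤ profileLogLik hn (groups ω) z :=
    (le_iSup₂_of_le θ.A θ.conn le_rfl).trans (hz _)
  rw [logLik_eq _ _ θ.conn.nonneg θ.conn.le_one] at hprof
  constructor
  -- Some admissible matrix has positive likelihood under `z`; as its leader entries are 1, a
  -- missing leader would contribute a factor 0.
  · have hbot : ⊥ < profileLogLik hn (groups ω) z :=
      lt_of_lt_of_le (ENNReal.bot_lt_log_iff.mpr (ENNReal.ofReal_pos.mpr hpos)) hprof
    obtain ⟨A, hA⟩ := lt_iSup_iff.mp hbot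
    obtain ⟨hA, hlt⟩ := lt_iSup_iff.mp hA
    rw [logLik_eq _ _ hA.nonneg hA.le_one, ENNReal.bot_lt_log_iff, ENNReal.ofReal_pos] at hlt
    intro t k hk
    by_contra hg
    refine hlt.ne' (Finset.prod_eq_zero (Finset.mem_univ t)
      (Finset.prod_eq_zero (Finset.mem_univ (Fin.castLE hn k)) ?_))
    rw [hk, hA.diag]
    simp [bernWeight, groups, hg]
  · obtain ⟨m, hm⟩ := exists_lik_le_freqMatrix (groups ω) z
    refine ⟨m, ?_⟩
    have h2 : profileLogLik hn (groups ω) z ≤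
        ENNReal.log (ENNReal.ofReal (lik (groups ω) z (freqMatrix z m))) := by
      refine iSup₂_le fun A hA => ?_
      rw [logLik_eq _ _ hA.nonneg hA.le_one]
      exact ENNReal.log_le_log (ENNReal.ofReal_le_ofReal (hm A hA.nonneg hA.le_one))
    have h3 := ENNReal.log_le_log_iff.mp (hprof.trans h2)
    exact (ENNReal.ofReal_le_ofReal_iff
      (lik_nonneg _ _ (freqMatrix_nonneg z m) (freqMatrix_le_one z m))).mp h3

end Likelihood

/-! ### Likelihood ratios and the Hellinger affinity -/

/-- The affinity is 1 minus half the squared Hellinger distance, of which only `(√p - √q)²` is kept;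
since `√p + √q ≤ 2`, that term is at least `(p - q)² / 4`. -/
lemma bern_affinity_le {p q : ℝ} (hp0 : 0 ≤ p) (hp1 : p ≤ 1) (hq0 : 0 ≤ q) (hq1 : q ≤ 1) :
    √(p * q) + √((1 - p) * (1 - q)) ≤ Real.exp (-((p - q) ^ 2 / 8)) := by
  refine le_trans ?_ (Real.add_one_le_exp _)
  rw [Real.sqrt_mul hp0, Real.sqrt_mul (by linarith)]
  have a1 := Real.sq_sqrt hp0
  have a2 := Real.sq_sqrt hq0
  have a3 := Real.sq_sqrt (show 0 ≤ 1 - p by linarith)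
  have a4 := Real.sq_sqrt (show 0 ≤ 1 - q by linarith)
  have b1 := Real.sqrt_nonneg p
  have b2 := Real.sqrt_nonneg q
  have c1 : √p ≤ 1 := Real.sqrt_le_one.mpr hp1
  have c2 : √q ≤ 1 := Real.sqrt_le_one.mpr hq1
  have hd : (p - q) ^ 2 ≤ 4 * (√p - √q) ^ 2 := by
    have : (p - q) ^ 2 = (√p + √q) ^ 2 * (√p - √q) ^ 2 := by
      rw [← mul_pow]; congr 1; nlinarith
    rw [this]
    have : (√p + √q) ^ 2 ≤ 4 := by nlinarith
    exact mul_le_mul_of_nonneg_right this (sq_nonneg _)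
  nlinarith [sq_nonneg (√(1 - p) - √(1 - q))]

lemma sum_sqrt_bernWeight (p q : ℝ) :
    ∑ b, √(bernWeight p b * bernWeight q b) = √(p * q) + √((1 - p) * (1 - q)) := by
  simp [bernWeight]

section Model

variable {nL n T : ℕ} {hn : nL ≤ n} (θ : Params hn)

/-- The squared distance between the true success probabilities and those given by the labels `z`
and the matrix `Q`. -/
def sqDist (zs z : Fin T → Fin (nL + 1)) (A Q : Fin (nL + 1) → Fin n → ℝ) : ℝ :=
  ∑ t, ∑ j, (A (zs t) j - Q (z t) j) ^ 2

/-- One factor of the exponentially tilted affinity. -/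
def tilted (q : Fin n → ℝ) (x : Fin (nL + 1) × (Fin n → Bool)) : ℝ :=
  θ.ρ x.1 * ∏ j, (√(bernWeight (θ.A x.1 j) (x.2 j) * bernWeight (q j) (x.2 j)) *
    Real.exp ((θ.A x.1 j - q j) ^ 2 / 8))

lemma tilted_nonneg (q : Fin n → ℝ) (x : Fin (nL + 1) × (Fin n → Bool)) : 0 ≤ tilted θ q x :=
  mul_nonneg (θ.ρ_nonneg _) (Finset.prod_nonneg fun _ _ => by positivity)

/-- The exponential factor exactly offsets the affinity bound, for each true label separately.
Having it inside the sum handles a distance that depends on the random labels, without conditioning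
on them. -/
lemma sum_tilted_le_one {q : Fin n → ℝ} (h0 : ∀ j, 0 ≤ q j) (h1 : ∀ j, q j ≤ 1) :
    ∑ x, tilted θ q x ≤ 1 := by
  rw [Fintype.sum_prod_type, ← θ.ρ_sum]
  refine Finset.sum_le_sum fun i _ => ?_
  simp only [tilted]
  rw [← Finset.mul_sum]
  refine mul_le_of_le_one_right (θ.ρ_nonneg i) ?_
  have := Finset.prod_univ_sum (fun _ : Fin n => (Finset.univ : Finset Bool))
    (fun j b => √(bernWeight (θ.A i j) b * bernWeight (q j) b) *
      Real.exp ((θ.A i j - q j) ^ 2 / 8))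
  rw [Fintype.piFinset_univ] at this
  rw [← this]
  refine Finset.prod_le_one (fun j _ => Finset.sum_nonneg fun b _ => by positivity) fun j _ => ?_
  rw [← Finset.sum_mul, sum_sqrt_bernWeight]
  calc _ ≤ Real.exp (-((θ.A i j - q j) ^ 2 / 8)) * Real.exp ((θ.A i j - q j) ^ 2 / 8) := by
        gcongr
        exact bern_affinity_le (θ.conn.nonneg i j) (θ.conn.le_one i j) (h0 j) (h1 j)
    _ = 1 := by rw [← Real.exp_add]; simp

lemma sqrt_prod {ι : Type*} (s : Finset ι) (f : ι → ℝ) (hf : ∀ i ∈ s, 0 ≤ f i) :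
    √(∏ i ∈ s, f i) = ∏ i ∈ s, √(f i) := by
  classical
  induction s using Finset.induction_on with
  | empty => simp
  | insert a s ha ih =>
    rw [Finset.prod_insert ha, Finset.prod_insert ha, Real.sqrt_mul (hf a (by simp)),
      ih fun i hi => hf i (by simp [hi])]

lemma prod_tilted {ω : Sample nL n T} (z : Fin T → Fin (nL + 1)) {Q : Fin (nL + 1) → Fin n → ℝ}
    (h0 : ∀ i j, 0 ≤ Q i j) (h1 : ∀ i j, Q i j ≤ 1) :
    ∏ t, tilted θ (Q (z t)) (ω t) = (∏ t, θ.ρ (ω t).1) *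
      √(lik (groups ω) (trueLabels ω) θ.A * lik (groups ω) z Q) *
      Real.exp (sqDist (trueLabels ω) z θ.A Q / 8) := by
  have hb : ∀ t j, 0 ≤ bernWeight (θ.A (ω t).1 j) ((ω t).2 j) * bernWeight (Q (z t) j) ((ω t).2 j) :=
    fun t j => mul_nonneg (bernWeight_nonneg (θ.conn.nonneg _ _) (θ.conn.le_one _ _) _)
      (bernWeight_nonneg (h0 _ _) (h1 _ _) _)
  simp only [tilted, lik, groups, trueLabels, sqDist]
  simp only [← Finset.prod_mul_distrib]
  rw [sqrt_prod _ _ fun t _ => Finset.prod_nonneg fun j _ => hb t j]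
  simp only [Finset.prod_mul_distrib, Finset.sum_div, Real.exp_sum]
  rw [mul_assoc]
  congr 2
  refine Finset.prod_congr rfl fun t _ => ?_
  rw [← sqrt_prod _ _ fun j _ => hb t j, Finset.prod_mul_distrib]

open Classical in
/-- A fixed alternative at squared distance `s` beats the truth with exponentially small
probability. -/
lemma sampleLaw_lik_le (z : Fin T → Fin (nL + 1)) {Q : Fin (nL + 1) → Fin n → ℝ}
    (h0 : ∀ i j, 0 ≤ Q i j) (h1 : ∀ i j, Q i j ≤ 1) (s : ℝ) :
    sampleLaw θ T {ω | lik (groups ω) (trueLabels ω) θ.A ≤ lik (groups ω) z Q ∧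
      s ≤ sqDist (trueLabels ω) z θ.A Q} ≤ ENNReal.ofReal (Real.exp (-(s / 8))) := by
  generalize hS : {ω : Sample nL n T | lik (groups ω) (trueLabels ω) θ.A ≤ lik (groups ω) z Q ∧
    s ≤ sqDist (trueLabels ω) z θ.A Q} = S
  rw [sampleLaw_eq_sum]
  refine ENNReal.ofReal_le_ofReal ?_
  have hbound : ∑ ω : Sample nL n T, ∏ t, tilted θ (Q (z t)) (ω t) ≤ 1 := by
    have := Finset.prod_univ_sum
      (fun _ : Fin T => (Finset.univ : Finset (Fin (nL + 1) × (Fin n → Bool))))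
      (fun t x => tilted θ (Q (z t)) x)
    rw [Fintype.piFinset_univ] at this
    rw [← this]
    exact Finset.prod_le_one (fun t _ => Finset.sum_nonneg fun x _ => tilted_nonneg θ _ x)
      fun t _ => sum_tilted_le_one θ (h0 _) (h1 _)
  calc ∑ ω with ω ∈ S, sampleWeight θ ω ≤ ∑ ω with ω ∈ S, Real.exp (-(s / 8)) * ∏ t, tilted θ (Q (z t)) (ω t) := by
        refine Finset.sum_le_sum fun ω hω => ?_
        obtain ⟨hl, hs⟩ := hS.symm.subset (Finset.mem_filter.mp hω).2
        have hl0 := lik_nonneg (groups ω) (trueLabels ω) θ.conn.nonneg θ.conn.le_one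
        have hρ : 0 ≤ ∏ t, θ.ρ (ω t).1 := Finset.prod_nonneg fun t _ => θ.ρ_nonneg _
        rw [sampleWeight_eq, prod_tilted θ z h0 h1]
        -- On the event, the likelihood ratio to the power 1/2 is at least 1.
        have hsq : lik (groups ω) (trueLabels ω) θ.A ≤
            √(lik (groups ω) (trueLabels ω) θ.A * lik (groups ω) z Q) :=
          Real.le_sqrt_of_sq_le (by rw [sq]; exact mul_le_mul_of_nonneg_left hl hl0)
        have he : 1 ≤ Real.exp (-(s / 8)) * Real.exp (sqDist (trueLabels ω) z θ.A Q / 8) := by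
          rw [← Real.exp_add]
          exact Real.one_le_exp (by linarith)
        calc _ ≤ (∏ t, θ.ρ (ω t).1) *
              √(lik (groups ω) (trueLabels ω) θ.A * lik (groups ω) z Q) * 1 := by
              rw [mul_one]; gcongr
          _ ≤ (∏ t, θ.ρ (ω t).1) * √(lik (groups ω) (trueLabels ω) θ.A * lik (groups ω) z Q) *
              (Real.exp (-(s / 8)) * Real.exp (sqDist (trueLabels ω) z θ.A Q / 8)) := by gcongr
          _ = _ := by ring
    _ ≤ ∑ ω : Sample nL n T, Real.exp (-(s / 8)) * ∏ t, tilted θ (Q (z t)) (ω t) := by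
        refine Finset.sum_le_sum_of_subset_of_nonneg (Finset.subset_univ _) fun ω _ _ => ?_
        exact mul_nonneg (Real.exp_pos _).le (Finset.prod_nonneg fun t _ => tilted_nonneg θ _ _)
    _ ≤ Real.exp (-(s / 8)) := by
        rw [← Finset.mul_sum]
        exact mul_le_of_le_one_right (Real.exp_pos _).le hbound

/-- A union bound over all labels and all matrices of frequencies. -/
lemma sampleLaw_exists_lik_le (s : ℝ) :
    sampleLaw θ T {ω | ∃ z m, lik (groups ω) (trueLabels ω) θ.A ≤ lik (groups ω) z (freqMatrix z m) ∧
      s ≤ sqDist (trueLabels ω) z θ.A (freqMatrix z m)} ≤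
    ENNReal.ofReal (Real.exp (T * Real.log (nL + 1) + (nL + 1) * n * Real.log (T + 1) - s / 8)) := by
  have hset : {ω : Sample nL n T | ∃ z m,
      lik (groups ω) (trueLabels ω) θ.A ≤ lik (groups ω) z (freqMatrix z m) ∧
        s ≤ sqDist (trueLabels ω) z θ.A (freqMatrix z m)} =
      ⋃ y ∈ (Finset.univ : Finset ((Fin T → Fin (nL + 1)) × (Fin (nL + 1) → Fin n → Fin (T + 1)))),
        {ω : Sample nL n T |
          lik (groups ω) (trueLabels ω) θ.A ≤ lik (groups ω) y.1 (freqMatrix y.1 y.2) ∧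
            s ≤ sqDist (trueLabels ω) y.1 θ.A (freqMatrix y.1 y.2)} := by
    ext ω; simp
  rw [hset]
  refine (measure_biUnion_finset_le _ _).trans ?_
  refine (Finset.sum_le_sum fun y _ => sampleLaw_lik_le θ y.1 (freqMatrix_nonneg _ _)
    (freqMatrix_le_one _ _) s).trans ?_
  rw [Finset.sum_const, nsmul_eq_mul, ← ENNReal.ofReal_natCast,
    ← ENNReal.ofReal_mul (Nat.cast_nonneg _)]
  refine ENNReal.ofReal_le_ofReal (le_of_eq ?_)
  -- The exponential of the first two terms is the number of pairs, `(nL+1)^T * (T+1)^((nL+1) n)`.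
  rw [sub_eq_add_neg, Real.exp_add, Real.exp_add, mul_comm (T : ℝ), Real.exp_mul,
    Real.exp_log (by positivity), mul_comm _ (Real.log (T + 1 : ℝ)), Real.exp_mul,
    Real.exp_log (by positivity)]
  congr 1
  rw [show ((nL : ℝ) + 1) * n = ((n * (nL + 1) : ℕ) : ℝ) by push_cast; ring, Real.rpow_natCast,
    Real.rpow_natCast]
  simp [pow_mul]

end Model

/-! ### Purity of the estimated classes -/

section Purity

variable {nL n T : ℕ}

/-- Of two distinct labels at least one is a leader, and its separating set suffices by symmetry. -/
lemma Separated.le_sum_sq {A : Fin (nL + 1) → Fin n → ℝ} {d v : ℝ} (hA : Separated A d v)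
    (hd : 0 < d) {i k : Fin (nL + 1)} (hik : i ≠ k) :
    d ^ 2 * v * n / nL ≤ ∑ j, (A i j - A k j) ^ 2 := by
  wlog hi : i ≠ 0 generalizing i k
  · have hk : k ≠ 0 := by rintro rfl; exact hi hik
    refine (this hik.symm hk).trans_eq (Finset.sum_congr rfl fun j _ => by ring)
  obtain ⟨l, rfl⟩ := Fin.exists_succ_eq.mpr hi
  obtain ⟨V, hV, hsep⟩ := hA l
  calc d ^ 2 * v * n / nL = (v * n / nL) * d ^ 2 := by ring
    _ ≤ V.card * d ^ 2 := by gcongr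
    _ = ∑ j ∈ V, d ^ 2 := by simp
    _ ≤ ∑ j ∈ V, (A l.succ j - A k j) ^ 2 :=
        Finset.sum_le_sum fun j hj => pow_le_pow_left₀ hd.le (hsep j hj k hik.symm) 2
    _ ≤ _ := Finset.sum_le_sum_of_subset_of_nonneg (Finset.subset_univ _) fun _ _ _ => sq_nonneg _

/-- If the matrix `Q` together with the labels `z` is close to the truth, then almost all the
observations with a given label `z` share the same true label. -/
lemma Separated.exists_majority {A : Fin (nL + 1) → Fin n → ℝ} {d v : ℝ} (hA : Separated A d v)
    (hd : 0 < d) (Q : Fin (nL + 1) → Fin n → ℝ) : ∃ σ : Fin (nL + 1) → Fin (nL + 1),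
    ∀ zs z : Fin T → Fin (nL + 1),
      d ^ 2 * v * n / nL / 4 * ((Finset.univ.filter fun t => zs t ≠ σ (z t)).card : ℝ) ≤
        sqDist zs z A Q := by
  -- `σ k` is the row of `A` nearest to row `k` of `Q`. Any other row is at least half as far from
  -- `Q k` as from `A (σ k)`, whence the factor 1/4 in squares.
  choose σ hσ using fun k => Finite.exists_min fun i => ∑ j, (A i j - Q k j) ^ 2
  refine ⟨σ, fun zs z => ?_⟩
  have hrow : ∀ i k, i ≠ σ k → d ^ 2 * v * n / nL / 4 ≤ ∑ j, (A i j - Q k j) ^ 2 := by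
    intro i k hik
    have h1 := hA.le_sum_sq hd hik
    have h2 : ∑ j, (A i j - A (σ k) j) ^ 2 ≤
        2 * ∑ j, (A i j - Q k j) ^ 2 + 2 * ∑ j, (A (σ k) j - Q k j) ^ 2 := by
      rw [Finset.mul_sum, Finset.mul_sum, ← Finset.sum_add_distrib]
      refine Finset.sum_le_sum fun j _ => ?_
      nlinarith [sq_nonneg ((A i j - Q k j) + (A (σ k) j - Q k j))]
    linarith [hσ k i]
  calc _ = ∑ t with zs t ≠ σ (z t), d ^ 2 * v * n / nL / 4 := by
        rw [Finset.sum_const, nsmul_eq_mul, mul_comm]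
    _ ≤ ∑ t with zs t ≠ σ (z t), ∑ j, (A (zs t) j - Q (z t) j) ^ 2 :=
        Finset.sum_le_sum fun t ht => hrow _ _ (Finset.mem_filter.mp ht).2
    _ ≤ _ := Finset.sum_le_sum_of_subset_of_nonneg (Finset.subset_univ _)
        fun _ _ _ => Finset.sum_nonneg fun _ _ => sq_nonneg _

/-- Labels `z` that respect the hubs, and whose classes are pure up to `η T` observations when the
class `k` is attributed to the true label `σ k`. -/
def IsPure (hn : nL ≤ n) (ω : Sample nL n T) (z : Fin T → Fin (nL + 1)) (η : ℝ)
    (σ : Fin (nL + 1) → Fin (nL + 1)) : Prop :=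
  ((Finset.univ.filter fun t => trueLabels ω t ≠ σ (z t)).card : ℝ) ≤ η * T ∧
    ∀ (t : Fin T) (k : Fin nL), z t = k.succ → (ω t).2 (Fin.castLE hn k) = true

/-- Off a null set, an impure estimate is a competitor at least as likely as the truth and far from
it. The fitted matrix depends on the sample, hence the uniform bound. -/
lemma sampleLaw_not_isPure {hn : nL ≤ n} (θ : Params hn) {d v η : ℝ} (hA : Separated θ.A d v)
    (hd : 0 < d) (hv : 0 < v) {zhat : Sample nL n T → Fin T → Fin (nL + 1)}
    (hz : ∀ ω, IsMaxProfile hn (groups ω) (zhat ω)) :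
    sampleLaw θ T {ω | ¬ ∃ σ, IsPure hn ω (zhat ω) η σ} ≤
      ENNReal.ofReal (Real.exp (T * Real.log (nL + 1) + (nL + 1) * n * Real.log (T + 1) -
        d ^ 2 * v * n / nL / 4 * (η * T) / 8)) := by
  have hnull : sampleLaw θ T {ω | sampleWeight θ ω = 0} = 0 := by
    rw [sampleLaw_eq_sum, Finset.sum_eq_zero, ENNReal.ofReal_zero]
    intro ω hω
    exact (Finset.mem_filter.mp hω).2
  have hU := (measure_union_le {ω : Sample nL n T | sampleWeight θ ω = 0} _).trans
    (add_le_add hnull.le (sampleLaw_exists_lik_le θ (d ^ 2 * v * n / nL / 4 * (η * T))))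
  rw [zero_add] at hU
  refine (measure_mono ?_).trans hU
  intro ω hω
  by_cases h0 : sampleWeight θ ω = 0
  · exact Or.inl h0
  right
  obtain ⟨hfeas, m, hm⟩ := (hz ω).spec θ h0
  refine ⟨zhat ω, m, hm, ?_⟩
  obtain ⟨σ, hσ⟩ := hA.exists_majority (T := T) hd (freqMatrix (zhat ω) m)
  refine le_trans ?_ (hσ (trueLabels ω) (zhat ω))
  refine mul_le_mul_of_nonneg_left ?_ (by positivity)
  by_contra hlt
  exact hω ⟨σ, (not_le.mp hlt).le, hfeas⟩

end Purity

/-! ### From pure classes to few errors -/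

section Deterministic

variable {nL n T : ℕ} {hn : nL ≤ n} {ω : Sample nL n T} {z : Fin T → Fin (nL + 1)} {η : ℝ}
  {σ : Fin (nL + 1) → Fin (nL + 1)}

/-- A pure class attributed to the wrong leader consists of observations of another label that
contain that leader. -/
lemma IsPure.card_class_le (h : IsPure hn ω z η σ) (k : Fin nL) :
    (Finset.univ.filter fun t => z t = k.succ ∧ trueLabels ω t = σ k.succ).card ≤
      (Finset.univ.filter fun t =>
        (ω t).1 = σ k.succ ∧ (ω t).2 (Fin.castLE hn k) = true).card := by
  refine Finset.card_le_card fun t ht => ?_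
  obtain ⟨h1, h2⟩ := (Finset.mem_filter.mp ht).2
  exact Finset.mem_filter.mpr ⟨Finset.mem_univ _, h2, h.2 t k h1⟩

/-- Few errors when every label other than `0` is rare and every leader rarely joins the groups of
another label. -/
lemma IsPure.errorRate_le_of_rare (h : IsPure hn ω z η σ) (hT : 0 < T) {a c : ℝ} (ha : 0 ≤ a)
    (hc : 0 ≤ c)
    (hlab : ∀ i : Fin nL, ((Finset.univ.filter fun t => (ω t).1 = i.succ).card : ℝ) ≤ a * T)
    (hhub : ∀ (i : Fin (nL + 1)) (k : Fin nL), i ≠ k.succ →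
      ((Finset.univ.filter fun t =>
        (ω t).1 = i ∧ (ω t).2 (Fin.castLE hn k) = true).card : ℝ) ≤ c * T) :
    errorRate (trueLabels ω) z ≤ η + a + nL * c := by
  have hT' : (0 : ℝ) < T := by exact_mod_cast hT
  rw [errorRate, div_le_iff₀ hT']
  have hsub : (Finset.univ.filter fun t => trueLabels ω t ≠ z t) ⊆
      (Finset.univ.filter fun t => trueLabels ω t ≠ σ (z t)) ∪
        Finset.univ.biUnion fun k => Finset.univ.filter fun t =>
          (z t = k ∧ trueLabels ω t = σ k) ∧ σ k ≠ k := by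
    intro t ht
    have hne := (Finset.mem_filter.mp ht).2
    by_cases hσ : trueLabels ω t = σ (z t)
    · refine Finset.mem_union_right _ (Finset.mem_biUnion.mpr ⟨z t, Finset.mem_univ _, ?_⟩)
      exact Finset.mem_filter.mpr ⟨Finset.mem_univ _, ⟨rfl, hσ⟩, hσ ▸ hne⟩
    · exact Finset.mem_union_left _ (Finset.mem_filter.mpr ⟨Finset.mem_univ _, hσ⟩)
  have hcard := (Finset.card_le_card hsub).trans
    ((Finset.card_union_le _ _).trans (Nat.add_le_add_left Finset.card_biUnion_le _))
  rw [Fin.sum_univ_succ] at hcard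
  -- Class `0` requires no leader to be present, so only the size of the label `σ 0` bounds it.
  have h0 : ((Finset.univ.filter fun t =>
      (z t = 0 ∧ trueLabels ω t = σ 0) ∧ σ 0 ≠ 0).card : ℝ) ≤ a * T := by
    by_cases hσ : σ 0 = 0
    · simp only [hσ, ne_eq, not_true_eq_false, and_false, Finset.filter_false, Finset.card_empty,
        Nat.cast_zero]
      positivity
    · obtain ⟨i, hi⟩ := Fin.exists_succ_eq.mpr hσ
      refine le_trans (Nat.cast_le.mpr (Finset.card_le_card fun t ht => ?_)) (hlab i)
      exact Finset.mem_filter.mpr ⟨Finset.mem_univ _, (Finset.mem_filter.mp ht).2.1.2.trans hi.symm⟩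
  have hk : ∀ k : Fin nL, ((Finset.univ.filter fun t =>
      (z t = k.succ ∧ trueLabels ω t = σ k.succ) ∧ σ k.succ ≠ k.succ).card : ℝ) ≤ c * T := by
    intro k
    by_cases hσ : σ k.succ = k.succ
    · simp only [hσ, ne_eq, not_true_eq_false, and_false, Finset.filter_false, Finset.card_empty,
        Nat.cast_zero]
      positivity
    · refine le_trans (Nat.cast_le.mpr (le_trans (Finset.card_le_card fun t ht => ?_)
        (h.card_class_le k))) (hhub _ k hσ)
      exact Finset.mem_filter.mpr ⟨Finset.mem_univ _, (Finset.mem_filter.mp ht).2.1⟩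
  have hsum : ∑ k : Fin nL, ((Finset.univ.filter fun t =>
      (z t = k.succ ∧ trueLabels ω t = σ k.succ) ∧ σ k.succ ≠ k.succ).card : ℝ) ≤
      nL * (c * T) := (Finset.sum_le_sum fun k _ => hk k).trans_eq (by simp)
  have hcard' : ((Finset.univ.filter fun t => trueLabels ω t ≠ z t).card : ℝ) ≤ _ :=
    Nat.cast_le.mpr hcard
  push_cast at hcard'
  linarith [h.1]

/-- Few errors when every label is frequent and no leader joins almost all groups of another
label. -/
lemma IsPure.errorRate_le_of_frequent (h : IsPure hn ω z η σ) (hT : 0 < T) {ρ : Fin (nL + 1) → ℝ}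
    {cmin b : ℝ} (hρ : ∀ i, cmin ≤ ρ i) (hb : b < 1) (hη : 2 * η < cmin)
    (hη' : 3 * η < (1 - b) * cmin)
    (hlab : ∀ i, (ρ i - η) * T ≤ ((Finset.univ.filter fun t => (ω t).1 = i).card : ℝ))
    (hhub : ∀ (i : Fin (nL + 1)) (k : Fin nL), i ≠ k.succ →
      ((Finset.univ.filter fun t =>
        (ω t).1 = i ∧ (ω t).2 (Fin.castLE hn k) = true).card : ℝ) ≤ (ρ i * b + η) * T) :
    errorRate (trueLabels ω) z ≤ η := by
  have hT' : (0 : ℝ) < T := by exact_mod_cast hT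
  have hsplit : ∀ i, (ρ i - η) * T ≤
      ((Finset.univ.filter fun t => σ (z t) = i ∧ trueLabels ω t = i).card : ℝ) + η * T := by
    intro i
    refine (hlab i).trans ?_
    have hsub : (Finset.univ.filter fun t => (ω t).1 = i) ⊆
        (Finset.univ.filter fun t => σ (z t) = i ∧ trueLabels ω t = i) ∪
          (Finset.univ.filter fun t => trueLabels ω t ≠ σ (z t)) := by
      intro t ht
      have hi : trueLabels ω t = i := (Finset.mem_filter.mp ht).2
      by_cases hσ : σ (z t) = i
      · exact Finset.mem_union_left _ (Finset.mem_filter.mpr ⟨Finset.mem_univ _, hσ, hi⟩)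
      · refine Finset.mem_union_right _ (Finset.mem_filter.mpr ⟨Finset.mem_univ _, ?_⟩)
        rw [hi]
        exact Ne.symm hσ
    have hcard : ((Finset.univ.filter fun t => (ω t).1 = i).card : ℝ) ≤ _ :=
      Nat.cast_le.mpr ((Finset.card_le_card hsub).trans (Finset.card_union_le _ _))
    push_cast at hcard
    linarith [h.1]
  -- All groups of a missed label would be impure, yet there are at least `(cmin - η) T > η T` of
  -- them.
  have hsurj : Function.Surjective σ := by
    intro i
    by_contra hi
    push Not at hi
    have := hsplit i
    rw [Finset.filter_false_of_mem fun t _ ht => hi _ ht.1, Finset.card_empty, Nat.cast_zero] at this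
    have h2 : (cmin - 2 * η) * T ≤ 0 := by nlinarith [hρ i]
    nlinarith
  have hinj : Function.Injective σ := Finite.injective_iff_surjective.mpr hsurj
  -- By injectivity one class carries all but `η T` groups of its label, so misattribution would
  -- give `ρ - 2η ≤ ρ b + η` for that label, against `3η < (1 - b) cmin`.
  have hsucc : ∀ k : Fin nL, σ k.succ = k.succ := by
    intro k
    by_contra hk
    have h1 := hsplit (σ k.succ)
    have h2 : ((Finset.univ.filter fun t =>
        σ (z t) = σ k.succ ∧ trueLabels ω t = σ k.succ).card : ℝ) ≤ (ρ (σ k.succ) * b + η) * T := by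
      refine le_trans ?_ (hhub _ k hk)
      simp only [hinj.eq_iff]
      exact_mod_cast h.card_class_le k
    have h3 : ((1 - b) * ρ (σ k.succ) - 3 * η) * T ≤ 0 := by linarith
    have h4 : (1 - b) * cmin ≤ (1 - b) * ρ (σ k.succ) :=
      mul_le_mul_of_nonneg_left (hρ _) (by linarith)
    nlinarith
  have hid : ∀ i, σ i = i := by
    refine Fin.cases ?_ hsucc
    by_contra h0
    obtain ⟨k, hk⟩ := Fin.exists_succ_eq.mpr h0
    have := hinj (hk.symm.trans (hsucc k).symm)
    exact (Fin.succ_ne_zero k) this.symm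
  rw [errorRate, div_le_iff₀ hT']
  simpa [hid] using h.1

end Deterministic

/-! ### Asymptotics -/

lemma Separated.le_one {nL n : ℕ} {hn : nL ≤ n} {θ : Params hn} {d v : ℝ}
    (hA : Separated θ.A d v) (hv : 0 < v) (hnL : 0 < nL) : d ≤ 1 := by
  obtain ⟨V, hV, hsep⟩ := hA ⟨0, hnL⟩
  have h1 : (0 : ℝ) < nL := by exact_mod_cast hnL
  have h2 : (0 : ℝ) < n := by exact_mod_cast hnL.trans_le hn
  have hpos : (0 : ℝ) < V.card := lt_of_lt_of_le (by positivity) hV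
  obtain ⟨j, hj⟩ := Finset.card_pos.mp (by exact_mod_cast hpos)
  have := hsep j hj 0 (Fin.succ_ne_zero _).symm
  linarith [θ.conn.le_one (Fin.succ ⟨0, hnL⟩) j, θ.conn.nonneg 0 j]

lemma Separated.le_card {nL n : ℕ} (hn : nL ≤ n) {A : Fin (nL + 1) → Fin n → ℝ} {d v : ℝ}
    (hA : Separated A d v) (hnL : 0 < nL) : v ≤ nL := by
  obtain ⟨V, hV, -⟩ := hA ⟨0, hnL⟩
  have h1 : (0 : ℝ) < nL := by exact_mod_cast hnL
  have h2 : (0 : ℝ) < n := by exact_mod_cast hnL.trans_le hn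
  have h3 : (V.card : ℝ) ≤ n := by exact_mod_cast (Finset.card_le_univ V).trans (by simp)
  have h4 := (div_le_iff₀ h1).mp (hV.trans h3)
  rw [mul_comm (n : ℝ)] at h4
  exact le_of_mul_le_mul_right h4 h2

/-- This lets hypotheses on `d⁴ v² n` control `d² v n`, at the price of a factor `nL`. -/
lemma Separated.sq_mul_le {nL n : ℕ} {hn : nL ≤ n} {θ : Params hn} {d v : ℝ}
    (hA : Separated θ.A d v) (hd : 0 < d) (hv : 0 < v) (hnL : 0 < nL) : d ^ 2 * v ≤ nL := by
  have h1 : d ^ 2 ≤ 1 := pow_le_one₀ hd.le (hA.le_one hv hnL)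
  nlinarith [hA.le_card hn hnL]

lemma log_succ_le {N : ℕ} (hN : 2 ≤ N) : Real.log (N + 1) ≤ 2 * Real.log N := by
  have h : (2 : ℝ) ≤ N := by exact_mod_cast hN
  have h2 : Real.log ((N : ℝ) ^ 2) = (2 : ℕ) * Real.log N := Real.log_pow _ _
  push_cast at h2
  rw [← h2]
  exact Real.log_le_log (by positivity) (by nlinarith)

/-- A union bound for the deviations of finitely many counts. -/
lemma sampleLaw_exists_deviation {nL n T : ℕ} {hn : nL ≤ n} (θ : Params hn) {ι : Type*}
    (I : Finset ι) (E : ι → Fin (nL + 1) × (Fin n → Bool) → Prop) [∀ i, DecidablePred (E i)]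
    {q s : ℝ} (hq : ∀ i ∈ I, (groupLaw θ).real {x | E i x} ≤ q) (hs : 0 < s) :
    sampleLaw θ T {ω | ∃ i ∈ I, s ≤ |((Finset.univ.filter fun t => E i (ω t)).card : ℝ) -
      T * (groupLaw θ).real {x | E i x}|} ≤ ENNReal.ofReal (I.card * (T * q / s ^ 2)) := by
  have hset : {ω : Sample nL n T | ∃ i ∈ I,
      s ≤ |((Finset.univ.filter fun t => E i (ω t)).card : ℝ) -
        T * (groupLaw θ).real {x | E i x}|} =
      ⋃ i ∈ I, {ω : Sample nL n T |
        s ≤ |((Finset.univ.filter fun t => E i (ω t)).card : ℝ) -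
          T * (groupLaw θ).real {x | E i x}|} := by
    ext ω; simp
  rw [hset]
  refine (measure_biUnion_finset_le _ _).trans ?_
  refine (Finset.sum_le_sum fun i hi => sampleLaw_count_deviation θ (E i) (hq i hi) hs).trans ?_
  rw [Finset.sum_const, nsmul_eq_mul, ← ENNReal.ofReal_natCast,
    ← ENNReal.ofReal_mul (Nat.cast_nonneg _)]

lemma tendsto_zero_of_le_ofReal {f : ℕ → ℝ≥0∞} {g : ℕ → ℝ} (hg : Tendsto g atTop (𝓝 0))
    (h : ∀ᶠ m in atTop, f m ≤ ENNReal.ofReal (g m)) : Tendsto f atTop (𝓝 0) := by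
  have := ENNReal.tendsto_ofReal hg
  rw [ENNReal.ofReal_zero] at this
  exact tendsto_of_tendsto_of_tendsto_of_le_of_le' tendsto_const_nhds this
    (Eventually.of_forall fun _ => zero_le) h

/-! ### Limits along a sequence of models -/

section Sequence

variable {nL n T : ℕ → ℕ} {hn : ∀ m, nL m ≤ n m} {θ : ∀ m, Params (hn m)} {d v : ℕ → ℝ}
  {zhat : ∀ m, Sample (nL m) (n m) (T m) → Fin (T m) → Fin (nL m + 1)}

lemma tendsto_sampleLaw_not_isPure
    (hz : ∀ m ω, IsMaxProfile (hn m) (groups ω) (zhat m ω))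
    (hnL : ∀ᶠ m in atTop, 0 < nL m) (hT : Tendsto T atTop atTop)
    (hd : ∀ m, 0 < d m) (hv : ∀ m, 0 < v m) (hA : ∀ m, Separated (θ m).A (d m) (v m))
    (h1 : Tendsto (fun m => (nL m : ℝ) * Real.log (nL m + 1) / (d m ^ 2 * v m * n m))
      atTop (𝓝 0))
    (h2 : Tendsto (fun m => ((nL m : ℝ) + 1) * nL m * Real.log (T m + 1) /
      (d m ^ 2 * v m * T m)) atTop (𝓝 0)) {η : ℝ} (hη : 0 < η) :
    Tendsto (fun m => sampleLaw (θ m) (T m) {ω | ¬ ∃ σ, IsPure (hn m) ω (zhat m ω) η σ})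
      atTop (𝓝 0) := by
  have hlog2 : 0 < Real.log 2 := Real.log_pos (by norm_num)
  have hlim : Tendsto (fun m => Real.exp (-(η / 64 * Real.log 2 * (T m : ℝ)))) atTop (𝓝 0) := by
    refine Real.tendsto_exp_neg_atTop_nhds_zero.comp ?_
    exact (tendsto_natCast_atTop_atTop.comp hT).const_mul_atTop (by positivity)
  refine tendsto_zero_of_le_ofReal hlim ?_
  -- With `X = T d² v n / nL` the gain is `η X / 32` and each entropy term at most `η X / 128`,
  -- leaving `-η X / 64`. The bound by 1 gives `X ≥ T log 2`, so this diverges.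
  filter_upwards [hnL, hT.eventually_gt_atTop 0, h1.eventually_lt_const one_pos,
    h1.eventually_lt_const (show 0 < η / 128 by positivity),
    h2.eventually_lt_const (show 0 < η / 128 by positivity)] with m hnL hT e0 e1 e2
  refine (sampleLaw_not_isPure (θ m) (hA m) (hd m) (hv m) (hz m)).trans
    (ENNReal.ofReal_le_ofReal (Real.exp_le_exp.mpr ?_))
  have hd := hd m
  have hv := hv m
  have hnLr : (1 : ℝ) ≤ nL m := by exact_mod_cast hnL
  have hnr : (0 : ℝ) < n m := by exact_mod_cast hnL.trans_le (hn m)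
  have hTr : (0 : ℝ) < T m := by exact_mod_cast hT
  have hnL0 : (0 : ℝ) < nL m := by linarith
  set X : ℝ := T m * (d m ^ 2 * v m * n m / nL m) with hX
  have hX0 : 0 < X := by positivity
  have hlogle : Real.log 2 ≤ Real.log (nL m + 1) :=
    Real.log_le_log (by norm_num) (by linarith)
  have hXT : Real.log 2 * T m ≤ X := by
    rw [div_lt_one (by positivity)] at e0
    rw [hX, mul_comm]
    refine mul_le_mul_of_nonneg_left ?_ hTr.le
    rw [le_div_iff₀ hnL0]
    nlinarith
  have t1 : T m * Real.log (nL m + 1) ≤ η / 128 * X := by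
    have : T m * Real.log (nL m + 1) =
        (nL m : ℝ) * Real.log (nL m + 1) / (d m ^ 2 * v m * n m) * X := by
      rw [hX]; field_simp
    rw [this]
    exact mul_le_mul_of_nonneg_right e1.le hX0.le
  have t2 : ((nL m : ℝ) + 1) * n m * Real.log (T m + 1) ≤ η / 128 * X := by
    have : ((nL m : ℝ) + 1) * n m * Real.log (T m + 1) =
        ((nL m : ℝ) + 1) * nL m * Real.log (T m + 1) / (d m ^ 2 * v m * T m) * X := by
      rw [hX]; field_simp
    rw [this]
    exact mul_le_mul_of_nonneg_right e2.le hX0.le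
  have t3 : d m ^ 2 * v m * n m / nL m / 4 * (η * T m) / 8 = η / 32 * X := by rw [hX]; ring
  rw [t3]
  have t4 : η / 64 * Real.log 2 * T m ≤ η / 64 * X := by
    rw [mul_assoc]; exact mul_le_mul_of_nonneg_left hXT (by positivity)
  linarith

/-- Each count may deviate by `η T / nL`, so that `nL` leader classes still add only `η`. The total
error is `2η + O(1/nL)`, below `ε = 4η`. -/
theorem tendsto_errorRate_of_growing {cmax c₀ : ℝ}
    (hz : ∀ m ω, IsMaxProfile (hn m) (groups ω) (zhat m ω))
    (hnL : Tendsto nL atTop atTop) (hT : Tendsto T atTop atTop)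
    (hd : ∀ m, 0 < d m) (hv : ∀ m, 0 < v m)
    (hρ : ∀ m i, (θ m).ρ i ≤ cmax / (nL m : ℝ))
    (hA : ∀ m, Separated (θ m).A (d m) (v m))
    (hb : ∀ m, LeaderBound (hn m) (θ m).A (c₀ / (nL m : ℝ)))
    (h1 : Tendsto (fun m => (nL m : ℝ) ^ 2 * Real.log (nL m) / (T m : ℝ)) atTop (𝓝 0))
    (h2 : Tendsto (fun m => (nL m : ℝ) ^ 5 * Real.log (T m) / (d m ^ 2 * v m * (T m : ℝ)))
      atTop (𝓝 0))
    (h3 : Tendsto (fun m => (nL m : ℝ) ^ 8 * Real.log (nL m) / (d m ^ 4 * v m ^ 2 * (n m : ℝ)))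
      atTop (𝓝 0)) {ε : ℝ} (hε : 0 < ε) :
    Tendsto (fun m => sampleLaw (θ m) (T m)
      {ω | ε ≤ errorRate (trueLabels ω) (zhat m ω)}) atTop (𝓝 0) := by
  have hnL0 : ∀ᶠ m in atTop, 0 < nL m := hnL.eventually_gt_atTop 0
  have hnLr : Tendsto (fun m => (nL m : ℝ)) atTop atTop := tendsto_natCast_atTop_atTop.comp hnL
  set η : ℝ := ε / 4 with hηdef
  have hη : 0 < η := by positivity
  have r1 : Tendsto (fun m => (nL m : ℝ) * Real.log (nL m + 1) / (d m ^ 2 * v m * n m))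
      atTop (𝓝 0) := by
    have h3' := h3.const_mul 2
    rw [mul_zero] at h3'
    refine squeeze_zero' (Eventually.of_forall fun m => ?_) ?_ h3'
    · have := hd m; have := hv m
      have := Real.log_nonneg (show (1 : ℝ) ≤ nL m + 1 by simp)
      positivity
    filter_upwards [hnL.eventually_ge_atTop 2] with m hm
    have hd := hd m
    have hv := hv m
    have hnr : (0 : ℝ) < n m := by exact_mod_cast (show 0 < n m from by have := hn m; omega)
    have h2r : (2 : ℝ) ≤ nL m := by exact_mod_cast hm
    have h1r : (1 : ℝ) ≤ nL m := by linarith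
    have hlog := log_succ_le hm
    have hlog0 := Real.log_nonneg (show (1 : ℝ) ≤ nL m by linarith)
    have hdv := (hA m).sq_mul_le hd hv (by omega)
    have e : (nL m : ℝ) * Real.log (nL m + 1) / (d m ^ 2 * v m * n m) =
        (nL m : ℝ) * Real.log (nL m + 1) * (d m ^ 2 * v m) / (d m ^ 4 * v m ^ 2 * n m) := by
      field_simp
    rw [e, ← mul_div_assoc]
    refine div_le_div_of_nonneg_right ?_ (by positivity)
    calc (nL m : ℝ) * Real.log (nL m + 1) * (d m ^ 2 * v m)
        ≤ nL m * (2 * Real.log (nL m)) * nL m := by gcongr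
      _ = 2 * ((nL m : ℝ) ^ 2 * Real.log (nL m)) := by ring
      _ ≤ 2 * ((nL m : ℝ) ^ 8 * Real.log (nL m)) := by gcongr; norm_num
  have r2 : Tendsto (fun m => ((nL m : ℝ) + 1) * nL m * Real.log (T m + 1) /
      (d m ^ 2 * v m * T m)) atTop (𝓝 0) := by
    have h2' := h2.const_mul 4
    rw [mul_zero] at h2'
    refine squeeze_zero' (Eventually.of_forall fun m => ?_) ?_ h2'
    · have := hd m; have := hv m
      have := Real.log_nonneg (show (1 : ℝ) ≤ T m + 1 by simp)
      positivity
    filter_upwards [hnL0, hT.eventually_ge_atTop 2] with m hm hTm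
    have hd := hd m
    have hv := hv m
    have h1r : (1 : ℝ) ≤ nL m := by exact_mod_cast hm
    have h2r : (2 : ℝ) ≤ T m := by exact_mod_cast hTm
    have hlog := log_succ_le hTm
    have hlog0 := Real.log_nonneg (show (1 : ℝ) ≤ T m by linarith)
    have hlog1 := Real.log_nonneg (show (1 : ℝ) ≤ T m + 1 by linarith)
    rw [← mul_div_assoc]
    refine div_le_div_of_nonneg_right ?_ (by positivity)
    calc ((nL m : ℝ) + 1) * nL m * Real.log (T m + 1)
        ≤ (nL m + nL m) * nL m * (2 * Real.log (T m)) := by gcongr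
      _ = 4 * ((nL m : ℝ) ^ 2 * Real.log (T m)) := by ring
      _ ≤ 4 * ((nL m : ℝ) ^ 5 * Real.log (T m)) := by gcongr; norm_num
  have hpure := tendsto_sampleLaw_not_isPure hz hnL0 hT hd hv hA r1 r2 hη
  have hnT : Tendsto (fun m => (nL m : ℝ) ^ 2 / T m) atTop (𝓝 0) := by
    refine squeeze_zero' (Eventually.of_forall fun m => by positivity) ?_ h1
    filter_upwards [hnL.eventually_ge_atTop 3] with m hm
    have h3r : (3 : ℝ) ≤ nL m := by exact_mod_cast hm
    have : 1 ≤ Real.log (nL m) := by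
      rw [Real.le_log_iff_exp_le (by linarith)]
      exact Real.exp_one_lt_three.le.trans h3r
    gcongr
    exact le_mul_of_one_le_right (by positivity) this
  have hlab : Tendsto (fun m => sampleLaw (θ m) (T m) {ω | ∃ i ∈ (Finset.univ : Finset (Fin (nL m))),
      η * T m / nL m ≤ |((Finset.univ.filter fun t => (ω t).1 = i.succ).card : ℝ) -
        T m * (groupLaw (θ m)).real {x | x.1 = i.succ}|}) atTop (𝓝 0) := by
    have hlim := hnT.const_mul (cmax / η ^ 2)
    rw [mul_zero] at hlim
    refine tendsto_zero_of_le_ofReal hlim ?_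
    filter_upwards [hnL0, hT.eventually_gt_atTop 0] with m hm hTm
    have h1r : (0 : ℝ) < nL m := by exact_mod_cast hm
    have h2r : (0 : ℝ) < T m := by exact_mod_cast hTm
    refine (sampleLaw_exists_deviation (θ m) Finset.univ
      (fun (i : Fin (nL m)) x => x.1 = i.succ) (q := cmax / nL m)
      (fun i _ => (groupLaw_label (θ m) i.succ).trans_le (hρ m _)) (by positivity)).trans
      (ENNReal.ofReal_le_ofReal (le_of_eq ?_))
    rw [Finset.card_univ, Fintype.card_fin]
    field_simp
  have hhub : Tendsto (fun m => sampleLaw (θ m) (T m) {ω | ∃ y ∈ (Finset.univ.filter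
      fun y : Fin (nL m + 1) × Fin (nL m) => y.1 ≠ y.2.succ),
      η * T m / nL m ≤ |((Finset.univ.filter fun t =>
        (ω t).1 = y.1 ∧ (ω t).2 (Fin.castLE (hn m) y.2) = true).card : ℝ) -
        T m * (groupLaw (θ m)).real {x | x.1 = y.1 ∧ x.2 (Fin.castLE (hn m) y.2) = true}|})
      atTop (𝓝 0) := by
    -- At most `2 nL²` counts, each of variance at most `T cmax c₀ / nL²`, at deviation `η T / nL`:
    -- Chebyshev gives order `nL² / T`.
    have hlim := hnT.const_mul (2 * (cmax * c₀) / η ^ 2)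
    rw [mul_zero] at hlim
    refine tendsto_zero_of_le_ofReal hlim ?_
    filter_upwards [hnL0, hT.eventually_gt_atTop 0] with m hm hTm
    have h0r : (1 : ℝ) ≤ nL m := by exact_mod_cast hm
    have h1r : (0 : ℝ) < nL m := by linarith
    have h2r : (0 : ℝ) < T m := by exact_mod_cast hTm
    have hcmax : 0 ≤ cmax / nL m := ((θ m).ρ_nonneg 0).trans (hρ m 0)
    have hc₀ : 0 ≤ c₀ / nL m := ((θ m).conn.nonneg 0 _).trans
      (hb m 0 ⟨0, hm⟩ (Fin.succ_ne_zero _).symm)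
    refine (sampleLaw_exists_deviation (θ m) (Finset.univ.filter
      fun y : Fin (nL m + 1) × Fin (nL m) => y.1 ≠ y.2.succ)
      (fun y x => x.1 = y.1 ∧ x.2 (Fin.castLE (hn m) y.2) = true)
      (q := cmax / nL m * (c₀ / nL m)) (fun y hy => (groupLaw_label_mem (θ m) y.1 _).trans_le
        (mul_le_mul (hρ m _) (hb m _ _ (Finset.mem_filter.mp hy).2) ((θ m).conn.nonneg _ _) hcmax))
      (s := η * T m / nL m) (by positivity)).trans (ENNReal.ofReal_le_ofReal ?_)
    have hcard : ((Finset.univ.filter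
        fun y : Fin (nL m + 1) × Fin (nL m) => y.1 ≠ y.2.succ).card : ℝ) ≤ 2 * (nL m : ℝ) ^ 2 := by
      have : ((Finset.univ.filter
          fun y : Fin (nL m + 1) × Fin (nL m) => y.1 ≠ y.2.succ).card : ℝ) ≤
          ((nL m : ℝ) + 1) * nL m := by
        exact_mod_cast (Finset.card_le_univ _).trans (by simp)
      nlinarith
    have hq : 0 ≤ T m * (cmax / nL m * (c₀ / nL m)) / (η * T m / nL m) ^ 2 := by positivity
    refine (mul_le_mul_of_nonneg_right hcard hq).trans_eq ?_
    field_simp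
  have hsmall : Tendsto (fun m => (cmax + η + cmax * c₀) / (nL m : ℝ)) atTop (𝓝 0) :=
    hnLr.const_div_atTop _
  have hall := (hpure.add hlab).add hhub
  rw [add_zero, add_zero] at hall
  refine tendsto_of_tendsto_of_tendsto_of_le_of_le' tendsto_const_nhds hall
    (Eventually.of_forall fun _ => zero_le) ?_
  filter_upwards [hnL0, hT.eventually_gt_atTop 0, hsmall.eventually_lt_const hη]
    with m hm hTm hsm
  refine (measure_mono ?_).trans ((measure_union_le _ _).trans
    (add_le_add_left (measure_union_le _ _) _))
  intro ω hω
  by_contra hbad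
  simp only [Set.mem_union, Set.mem_ofPred_eq, not_or, not_not] at hbad
  obtain ⟨⟨⟨σ, hσ⟩, hl⟩, hh⟩ := hbad
  push Not at hl hh
  have h1r : (0 : ℝ) < nL m := by exact_mod_cast hm
  have h2r : (0 : ℝ) < T m := by exact_mod_cast hTm
  have hcmax : 0 ≤ cmax / nL m := ((θ m).ρ_nonneg 0).trans (hρ m 0)
  have hc₀ : 0 ≤ c₀ / nL m := ((θ m).conn.nonneg 0 _).trans
    (hb m 0 ⟨0, hm⟩ (Fin.succ_ne_zero _).symm)
  have herr := hσ.errorRate_le_of_rare hTm (a := cmax / nL m + η / nL m)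
    (c := cmax / nL m * (c₀ / nL m) + η / nL m) (by positivity) (by positivity)
    (fun i => by
      have h := (abs_lt.mp (hl i (Finset.mem_univ i))).2
      rw [groupLaw_label] at h
      have h' : T m * (θ m).ρ i.succ ≤ T m * (cmax / nL m) :=
        mul_le_mul_of_nonneg_left (hρ m _) h2r.le
      have e : (cmax / nL m + η / nL m) * T m = T m * (cmax / nL m) + η * T m / nL m := by ring
      linarith)
    (fun i k hik => by
      have h := (abs_lt.mp (hh (i, k) (Finset.mem_filter.mpr ⟨Finset.mem_univ _, hik⟩))).2
      rw [groupLaw_label_mem] at h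
      have h' : T m * ((θ m).ρ i * (θ m).A i (Fin.castLE (hn m) k)) ≤
          T m * (cmax / nL m * (c₀ / nL m)) :=
        mul_le_mul_of_nonneg_left
          (mul_le_mul (hρ m _) (hb m _ _ hik) ((θ m).conn.nonneg _ _) hcmax) h2r.le
      have e : (cmax / nL m * (c₀ / nL m) + η / nL m) * T m =
        T m * (cmax / nL m * (c₀ / nL m)) + η * T m / nL m := by ring
      linarith)
  have e : η + (cmax / nL m + η / nL m) + nL m * (cmax / nL m * (c₀ / nL m) + η / nL m) =
      2 * η + (cmax + η + cmax * c₀) / nL m := by field_simp; ring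
  rw [e] at herr
  have hω' : ε ≤ errorRate (trueLabels ω) (zhat m ω) := hω
  linarith

end Sequence

theorem tendsto_errorRate_of_fixed {nL : ℕ} {n T : ℕ → ℕ} {hn : ∀ m, nL ≤ n m}
    {θ : ∀ m, Params (hn m)} {d v : ℕ → ℝ} {cmin b : ℝ}
    {zhat : ∀ m, Sample nL (n m) (T m) → Fin (T m) → Fin (nL + 1)}
    (hz : ∀ m ω, IsMaxProfile (hn m) (groups ω) (zhat m ω))
    (hT : Tendsto T atTop atTop)
    (hd : ∀ m, 0 < d m) (hv : ∀ m, 0 < v m) (hcmin : 0 < cmin)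
    (hρ : ∀ m i, cmin ≤ (θ m).ρ i)
    (hA : ∀ m, Separated (θ m).A (d m) (v m)) (hb1 : b < 1)
    (hb : ∀ m, LeaderBound (hn m) (θ m).A b)
    (h1 : Tendsto (fun m => Real.log (T m) / (d m ^ 2 * v m * (T m : ℝ))) atTop (𝓝 0))
    (h2 : Tendsto (fun m => d m ^ 4 * v m ^ 2 * (n m : ℝ)) atTop atTop) {ε : ℝ} (hε : 0 < ε) :
    Tendsto (fun m => sampleLaw (θ m) (T m)
      {ω | ε ≤ errorRate (trueLabels ω) (zhat m ω)}) atTop (𝓝 0) := by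
  -- Without leaders there is a single label and no error is possible.
  rcases Nat.eq_zero_or_pos nL with rfl | hnL
  · have : ∀ m, {ω : Sample 0 (n m) (T m) | ε ≤ errorRate (trueLabels ω) (zhat m ω)} = ∅ := by
      intro m
      ext ω
      have h0 : errorRate (trueLabels ω) (zhat m ω) = 0 := by
        rw [errorRate, Finset.filter_false_of_mem fun t _ h => h (Subsingleton.elim (α := Fin 1) _ _)]
        simp
      simp [h0, hε]
    simp [this]
  obtain ⟨η, hη, hηε, hη2, hη3⟩ : ∃ η : ℝ, 0 < η ∧ η < ε ∧ 2 * η < cmin ∧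
      3 * η < (1 - b) * cmin := by
    have hbc : 0 < (1 - b) * cmin := mul_pos (by linarith) hcmin
    refine ⟨min (ε / 2) (min (cmin / 4) ((1 - b) * cmin / 4)), by positivity, ?_, ?_, ?_⟩
    · linarith [min_le_left (ε / 2) (min (cmin / 4) ((1 - b) * cmin / 4))]
    · linarith [(min_le_right (ε / 2) (min (cmin / 4) ((1 - b) * cmin / 4))).trans
        (min_le_left _ _)]
    · linarith [(min_le_right (ε / 2) (min (cmin / 4) ((1 - b) * cmin / 4))).trans
        (min_le_right _ _)]
  have hnLr : (0 : ℝ) < nL := by exact_mod_cast hnL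
  have hlogn : 0 ≤ Real.log ((nL : ℝ) + 1) := Real.log_nonneg (by simp)
  have r1 : Tendsto (fun m => (nL : ℝ) * Real.log (nL + 1) / (d m ^ 2 * v m * n m))
      atTop (𝓝 0) := by
    refine squeeze_zero (fun m => ?_) (fun m => ?_)
      (h2.const_div_atTop ((nL : ℝ) * Real.log (nL + 1) * nL))
    · have := hd m; have := hv m
      positivity
    have hd := hd m
    have hv := hv m
    have hnr : (0 : ℝ) < n m := by exact_mod_cast hnL.trans_le (hn m)
    have hdv := (hA m).sq_mul_le hd hv hnL
    have e : (nL : ℝ) * Real.log (nL + 1) / (d m ^ 2 * v m * n m) =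
        (nL : ℝ) * Real.log (nL + 1) * (d m ^ 2 * v m) / (d m ^ 4 * v m ^ 2 * n m) := by
      field_simp
    rw [e]
    gcongr
  have r2 : Tendsto (fun m => ((nL : ℝ) + 1) * nL * Real.log (T m + 1) /
      (d m ^ 2 * v m * T m)) atTop (𝓝 0) := by
    have h1' := h1.const_mul (((nL : ℝ) + 1) * nL * 2)
    rw [mul_zero] at h1'
    refine squeeze_zero' (Eventually.of_forall fun m => ?_) ?_ h1'
    · have := hd m; have := hv m
      have := Real.log_nonneg (show (1 : ℝ) ≤ T m + 1 by simp)
      positivity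
    filter_upwards [hT.eventually_ge_atTop 2] with m hTm
    have hd := hd m
    have hv := hv m
    rw [← mul_div_assoc, mul_assoc _ (2 : ℝ)]
    gcongr
    exact log_succ_le hTm
  have hpure := tendsto_sampleLaw_not_isPure (nL := fun _ => nL) hz
    (Eventually.of_forall fun _ => hnL) hT hd hv hA r1 r2 hη
  have hTinv : Tendsto (fun m => (1 : ℝ) / T m) atTop (𝓝 0) :=
    (tendsto_natCast_atTop_atTop.comp hT).const_div_atTop 1
  -- The number of counts is fixed here, so the trivial bound `q = 1` suffices.
  have hdev : ∀ {ι : Type} (I : Finset ι)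
      (E : ∀ m, ι → Fin (nL + 1) × (Fin (n m) → Bool) → Prop) [∀ m i, DecidablePred (E m i)],
      Tendsto (fun m => sampleLaw (θ m) (T m) {ω | ∃ i ∈ I,
        η * T m ≤ |((Finset.univ.filter fun t => E m i (ω t)).card : ℝ) -
          T m * (groupLaw (θ m)).real {x | E m i x}|}) atTop (𝓝 0) := by
    intro ι I E _
    have hlim := hTinv.const_mul ((I.card : ℝ) / η ^ 2)
    rw [mul_zero] at hlim
    refine tendsto_zero_of_le_ofReal hlim ?_
    filter_upwards [hT.eventually_gt_atTop 0] with m hTm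
    have h2r : (0 : ℝ) < T m := by exact_mod_cast hTm
    refine (sampleLaw_exists_deviation (θ m) I (E m) (q := 1) (fun i _ => measureReal_le_one)
      (by positivity)).trans (ENNReal.ofReal_le_ofReal (le_of_eq ?_))
    field_simp
  have hlab := hdev (Finset.univ : Finset (Fin (nL + 1))) fun m i x => x.1 = i
  have hhub := hdev (Finset.univ : Finset (Fin (nL + 1) × Fin nL))
    fun m y x => x.1 = y.1 ∧ x.2 (Fin.castLE (hn m) y.2) = true
  have hall := (hpure.add hlab).add hhub
  rw [add_zero, add_zero] at hall
  refine tendsto_of_tendsto_of_tendsto_of_le_of_le' tendsto_const_nhds hall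
    (Eventually.of_forall fun _ => zero_le) ?_
  filter_upwards [hT.eventually_gt_atTop 0] with m hTm
  refine (measure_mono ?_).trans ((measure_union_le _ _).trans
    (add_le_add_left (measure_union_le _ _) _))
  intro ω hω
  by_contra hbad
  simp only [Set.mem_union, Set.mem_ofPred_eq, not_or, not_not] at hbad
  obtain ⟨⟨⟨σ, hσ⟩, hl⟩, hh⟩ := hbad
  push Not at hl hh
  have h2r : (0 : ℝ) < T m := by exact_mod_cast hTm
  have herr := hσ.errorRate_le_of_frequent hTm (ρ := (θ m).ρ) (hρ m) hb1 hη2 hη3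
    (fun i => by
      have h := (abs_lt.mp (hl i (Finset.mem_univ i))).1
      rw [groupLaw_label] at h
      linarith)
    (fun i k hik => by
      have h := (abs_lt.mp (hh (i, k) (Finset.mem_univ _))).2
      rw [groupLaw_label_mem] at h
      have h' : T m * ((θ m).ρ i * (θ m).A i (Fin.castLE (hn m) k)) ≤ T m * ((θ m).ρ i * b) :=
        mul_le_mul_of_nonneg_left
          (mul_le_mul_of_nonneg_left (hb m _ _ hik) ((θ m).ρ_nonneg i)) h2r.le
      linarith)
  have hω' : ε ≤ errorRate (trueLabels ω) (zhat m ω) := hω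
  linarith

end HubNull

end

theorem theorem9 :
    -- growing number of leaders
    (∀ (nL n T : ℕ → ℕ) (hn : ∀ m, nL m ≤ n m) (θ : ∀ m, HubNull.Params (hn m))
      (d v : ℕ → ℝ) (cmin cmax c₀ : ℝ)
      (zhat : ∀ m, HubNull.Sample (nL m) (n m) (T m) → Fin (T m) → Fin (nL m + 1)),
      (∀ m ω, HubNull.IsMaxProfile (hn m) (HubNull.groups ω) (zhat m ω)) →
      Tendsto nL atTop atTop → Tendsto n atTop atTop → Tendsto T atTop atTop →
      (∀ m, 0 < d m) → (∀ m, 0 < v m) →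
      0 < cmin →
      (∀ m i, cmin / (nL m : ℝ) ≤ (θ m).ρ i ∧ (θ m).ρ i ≤ cmax / (nL m : ℝ)) →
      (∀ m, HubNull.Separated (θ m).A (d m) (v m)) →
      (∀ m, HubNull.LeaderBound (hn m) (θ m).A (c₀ / (nL m : ℝ))) →
      Tendsto (fun m => (nL m : ℝ) ^ 2 * Real.log (nL m) / (T m : ℝ)) atTop (𝓝 0) →
      Tendsto (fun m => (nL m : ℝ) ^ 5 * Real.log (T m) / (d m ^ 2 * v m * (T m : ℝ)))
        atTop (𝓝 0) →
      Tendsto (fun m => (nL m : ℝ) ^ 8 * Real.log (nL m) / (d m ^ 4 * v m ^ 2 * (n m : ℝ)))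
        atTop (𝓝 0) →
      ∀ ε : ℝ, 0 < ε →
        Tendsto (fun m => HubNull.sampleLaw (θ m) (T m)
          {ω | ε ≤ HubNull.errorRate (HubNull.trueLabels ω) (zhat m ω)}) atTop (𝓝 0)) ∧
    -- fixed number of leaders
    (∀ (nL : ℕ) (n T : ℕ → ℕ) (hn : ∀ m, nL ≤ n m) (θ : ∀ m, HubNull.Params (hn m))
      (d v : ℕ → ℝ) (cmin b : ℝ)
      (zhat : ∀ m, HubNull.Sample nL (n m) (T m) → Fin (T m) → Fin (nL + 1)),
      (∀ m ω, HubNull.IsMaxProfile (hn m) (HubNull.groups ω) (zhat m ω)) →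
      Tendsto n atTop atTop → Tendsto T atTop atTop →
      (∀ m, 0 < d m) → (∀ m, 0 < v m) →
      0 < cmin →
      (∀ m i, cmin ≤ (θ m).ρ i) →
      (∀ m, HubNull.Separated (θ m).A (d m) (v m)) →
      b < 1 →
      (∀ m, HubNull.LeaderBound (hn m) (θ m).A b) →
      Tendsto (fun m => Real.log (T m) / (d m ^ 2 * v m * (T m : ℝ))) atTop (𝓝 0) →
      Tendsto (fun m => d m ^ 4 * v m ^ 2 * (n m : ℝ)) atTop atTop →
      ∀ ε : ℝ, 0 < ε →
        Tendsto (fun m => HubNull.sampleLaw (θ m) (T m)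
          {ω | ε ≤ HubNull.errorRate (HubNull.trueLabels ω) (zhat m ω)}) atTop (𝓝 0)) := by
  refine ⟨?_, ?_⟩
  · intro nL n T hn θ d v cmin cmax c₀ zhat hz hnL _ hT hd hv _ hρ hA hb h1 h2 h3 ε hε
    exact HubNull.tendsto_errorRate_of_growing hz hnL hT hd hv (fun m i => (hρ m i).2) hA hb
      h1 h2 h3 hε
  · intro nL n T hn θ d v cmin b zhat hz _ hT hd hv hcmin hρ hA hb1 hb h1 h2 ε hε
    exact HubNull.tendsto_errorRate_of_fixed hz hT hd hv hcmin hρ hA hb1 hb h1 h2 hε
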